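/- Consider a network with one transmitter, one receiver and $R\ge 1$ parallel amplify-and-forward relays. The channel state is $\mathbf h=(f_1,g_1,\dots,f_R,g_R)$, whose entries are independent with $f_r\sim\mathcal{CN}(0,\sigma_{f_r}^2)$ and $g_r\sim\mathcal{CN}(0,\sigma_{g_r}^2)$. Here $\mathcal{CN}(0,\sigma^2)$ is the zero-mean circularly symmetric complex Gaussian law with variance $\sigma^2/2$ per real dimension. The transmitter and relay powers are $P_r=p_rP$, $r=0,\dots,R$, where $p_0,\dots,p_R>0$ and all $\sigma_{f_r},\sigma_{g_r}>0$ are fixed. For $\mathbf x\in\mathbb C^R$ and $\rho_r=P_r/(1+|f_r|^2P_0)$ put $$\mathrm{SNR}_P(\mathbf x,\mathbf h)=\frac{P_0\left|\sum_{r=1}^R x_rf_rg_r\sqrt{\rho_r}\right|^2}{1+\sum_{r=1}^R|x_r|^2|g_r|^2\rho_r}.$$ Let $\mathcal C\subset\{\mathbf x\in\mathbb C^R:\|\mathbf x\|_\infty=1\}$ be a nonempty compact set (a power-independent codebook). For every $P>0$ and every $\mathbf h$ let $\mathcal Q_P(\mathbf h)\in\arg\max_{\mathbf x\in\mathcal C}\mathrm{SNR}_P(\mathbf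 x,\mathbf h)$, let $\mathrm{SER}_P=\mathrm E_{\mathbf h}\big[\mathrm Q\big(\sqrt{2\,\mathrm{SNR}_P(\mathcal Q_P(\mathbf h),\mathbf h)}\big)\big]$, where $\mathrm Q$ is the standard Gaussian tail function, and define the diversity of $\mathcal C$ as $\mathtt d(\mathcal C)=\lim_{P\to\infty}-\log\mathrm{SER}_P/\log P$. Then $\mathtt d(\mathcal C)=R$ (that is, the limit exists and equals $R$) if and only if there is $\boldsymbol\theta\in\mathbb R^R$ such that $\mathcal C$ contains the single-relay selection codebook $\{\mathbf e_r(\theta_r):r=1,\dots,R\}$, where $\mathbf e_r(\theta)\in\mathbb C^R$ has $r$-th entry $e^{i\theta}$ and all other entries $0$. -/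

import Mathlib

open MeasureTheory ProbabilityTheory Filter Topology

noncomputable section

/-- The Gaussian tail function: the probability that a standard real Gaussian exceeds `x`. -/
def gaussianTail (x : ℝ) : ℝ := (gaussianReal 0 1).real (Set.Ioi x)

/-- The circularly symmetric complex Gaussian law of mean zero and variance `σ ^ 2`: the real and
imaginary parts are independent real Gaussians of mean `0` and variance `σ ^ 2 / 2` each. -/
def complexGaussian (σ : ℝ) : Measure ℂ :=
  ((gaussianReal 0 (Real.toNNReal (σ ^ 2 / 2))).prod
    (gaussianReal 0 (Real.toNNReal (σ ^ 2 / 2)))).map Complex.measurableEquivRealProd.symm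

/-- A channel state: at relay `r`, the pair `(f r, g r)` of the coefficients of the channel from the
transmitter to the relay, and of the channel from the relay to the receiver. -/
abbrev ChannelState (R : ℕ) : Type := Fin R → ℂ × ℂ

/-- The fixed parameters of a network with one transmitter, one receiver and `R` parallel relays:
power scalers and channel standard deviations, all positive. -/
structure RelayNetwork (R : ℕ) where
  /-- power scaler of the transmitter -/
  p₀ : ℝ
  /-- power scalers of the relays -/
  p : Fin R → ℝ
  /-- standard deviations of the channels from the transmitter to the relays -/
  σf : Fin R → ℝ
  /-- standard deviations of the channels from the relays to the receiver -/
  σg : Fin R → ℝ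
  p₀_pos : 0 < p₀
  p_pos : ∀ r, 0 < p r
  σf_pos : ∀ r, 0 < σf r
  σg_pos : ∀ r, 0 < σg r

namespace RelayNetwork

variable {R : ℕ} (N : RelayNetwork R)

/-- The law of the channel state: all `2 * R` channel coefficients are independent, zero-mean
complex Gaussians with the given standard deviations. -/
def channelLaw : Measure (ChannelState R) :=
  Measure.pi fun r => (complexGaussian (N.σf r)).prod (complexGaussian (N.σg r))

/-- The normalization factor `P_r / (1 + |f_r|² P_0)` of relay `r`, with `P_r = p_r P`. -/
def relayFactor (P : ℝ) (h : ChannelState R) (r : Fin R) : ℝ :=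
  N.p r * P / (1 + ‖(h r).1‖ ^ 2 * (N.p₀ * P))

/-- The received signal-to-noise ratio with beamforming vector `x` and channel state `h`. -/
def snr (P : ℝ) (x : Fin R → ℂ) (h : ChannelState R) : ℝ :=
  N.p₀ * P * ‖∑ r, x r * (h r).1 * (h r).2 * (√(N.relayFactor P h r) : ℂ)‖ ^ 2 /
    (1 + ∑ r, ‖x r‖ ^ 2 * ‖(h r).2‖ ^ 2 * N.relayFactor P h r)

/-- The symbol error rate at power `P` when the beamforming vector `q h` is used in state `h`. -/
def ser (P : ℝ) (q : ChannelState R → Fin R → ℂ) : ℝ :=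
  ∫ h, gaussianTail (√(2 * N.snr P (q h) h)) ∂N.channelLaw

/-- The collection `Q` of quantizers (one for each power level) achieves diversity `d`:
the limit that defines the diversity exists and equals `d`. -/
def HasDiversity (Q : ℝ → ChannelState R → Fin R → ℂ) (d : ℝ) : Prop :=
  Tendsto (fun P : ℝ => -Real.log (N.ser P (Q P)) / Real.log P) atTop (𝓝 d)

/-- `Q` is a collection of optimal quantizers for the power-independent codebook `C`: at every
power level and in every channel state it selects a vector of `C` of maximal SNR. -/
def IsOptimalQuantizer (C : Set (Fin R → ℂ)) (Q : ℝ → ChannelState R → Fin R → ℂ) : Prop :=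
  ∀ P : ℝ, 0 < P → ∀ h, Q P h ∈ C ∧ ∀ x ∈ C, N.snr P x h ≤ N.snr P (Q P h) h

/-- Every nonempty compact codebook has a collection of optimal quantizers. -/
theorem exists_isOptimalQuantizer {C : Set (Fin R → ℂ)} (hC : IsCompact C) (hne : C.Nonempty) :
    ∃ Q, N.IsOptimalQuantizer C Q := by
  have key : ∀ (P : ℝ) (h : ChannelState R), ∃ x, 0 < P → x ∈ C ∧
      ∀ y ∈ C, N.snr P y h ≤ N.snr P x h := by
    intro P h
    by_cases hP : 0 < P
    · have hρ : ∀ r, 0 ≤ N.relayFactor P h r := fun r => by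
        have h1 := N.p_pos r
        have h2 := N.p₀_pos
        unfold relayFactor
        positivity
      have hc : Continuous fun x => N.snr P x h := by
        unfold snr
        refine Continuous.div (by fun_prop) (by fun_prop) fun x => ?_
        have : 0 ≤ ∑ r, ‖x r‖ ^ 2 * ‖(h r).2‖ ^ 2 * N.relayFactor P h r :=
          Finset.sum_nonneg fun r _ => mul_nonneg (by positivity) (hρ r)
        positivity
      obtain ⟨x, hx, hmax⟩ := hC.exists_isMaxOn hne hc.continuousOn
      exact ⟨x, fun _ => ⟨hx, fun y hy => hmax hy⟩⟩
    · exact ⟨0, fun h => absurd h hP⟩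
  choose Q hQ using key
  exact ⟨Q, fun P hP h => hQ P h hP⟩

end RelayNetwork

/-- The set of beamforming vectors with sup-norm `1` (the norm of `Fin R → ℂ` is the sup-norm). -/
def unitSupVectors (R : ℕ) : Set (Fin R → ℂ) := {x | ‖x‖ = 1}

/-- The single-relay selection vector with entry `exp (i t)` at `r` and `0` elsewhere. -/
def srsVector {R : ℕ} (r : Fin R) (t : ℝ) : Fin R → ℂ :=
  Pi.single r (Complex.exp (t * Complex.I))

/-- The single-relay selection codebook with phases `θ`. -/
def srsCodebook {R : ℕ} (θ : Fin R → ℝ) : Set (Fin R → ℂ) :=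
  Set.range fun r => srsVector r (θ r)

end

/-!
The theorem compares the error rate with powers of `P`.

* For every codebook, `SER ≥ c / P ^ R`: by Cauchy–Schwarz the SNR of any vector is at most
  `p₀ P ∑ ‖f r‖ ^ 2`, which is bounded when all `‖f r‖ ^ 2` are at most `1 / P`, an event of
  probability of order `P ^ (-R)` (`IsOptimalQuantizer.exists_div_pow_le_ser`).
* If the codebook contains a single-relay selection codebook, the optimal SNR is at least the mean
  over the relays of the single-relay SNRs `a b / (1 + a + b) ≥ min a b / 2 - 1 / 4`, where `a` and
  `b` are the powers of the two hops. With the Chernoff bound the error probability is at most a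
  product over the relays, each factor having mean of order `1 / P`, so `SER ≤ K / P ^ R`
  (`IsOptimalQuantizer.exists_ser_le_div_pow`).
* If for some relay `r` the codebook has no vector selecting `r` alone, compactness gives a `δ > 0`
  such that every codeword puts weight at least `δ` on the other relays. Consider the event that
  `‖f s‖ ^ 2 ≤ 1 / P` and `‖g s‖ ≥ 1` for `s ≠ r`, and `‖g r‖ ≤ 1`, which has probability of order
  `P ^ (-(R - 1))`. There the other relays carry a bounded signal but amplify noise to power of order
  `P`, and this noise drowns the signal through `r`: every codeword has bounded SNR. Hence
  `SER ≥ c / P ^ (R - 1)` (`IsOptimalQuantizer.exists_div_pow_pred_le_ser`), and the limit cannot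
  be `R`.
-/

open scoped NNReal

/-! ### Real and complex Gaussian laws -/

theorem gaussianTail_antitone : Antitone gaussianTail := fun _ _ h =>
  measureReal_mono (Set.Ioi_subset_Ioi h)

theorem gaussianTail_nonneg (x : ℝ) : 0 ≤ gaussianTail x := measureReal_nonneg

theorem gaussianTail_le_one (x : ℝ) : gaussianTail x ≤ 1 := measureReal_le_one

theorem gaussianReal_real_pos_of_volume_ne_zero {v : ℝ≥0} (hv : v ≠ 0) {s : Set ℝ}
    (hs : volume s ≠ 0) : 0 < (gaussianReal 0 v).real s :=
  ENNReal.toReal_pos (fun h => hs (gaussianReal_absolutelyContinuous' 0 hv h)) (measure_ne_top _ _)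

theorem gaussianTail_pos (x : ℝ) : 0 < gaussianTail x :=
  gaussianReal_real_pos_of_volume_ne_zero one_ne_zero (by simp)

/-- The Chernoff bound for the Gaussian tail. -/
theorem gaussianTail_le_exp {x : ℝ} (hx : 0 ≤ x) : gaussianTail x ≤ Real.exp (-(x ^ 2 / 2)) := by
  have hexp := integrable_exp_mul_gaussianReal (μ := 0) (v := 1) x
  have h := measure_ge_le_exp_mul_mgf (μ := gaussianReal 0 1) (X := id) x hx hexp
  rw [mgf_id_gaussianReal, ← Real.exp_add] at h
  calc gaussianTail x ≤ (gaussianReal 0 1).real {ω | x ≤ id ω} :=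
        measureReal_mono fun y hy => (Set.mem_Ioi.1 hy).le
    _ ≤ _ := h
    _ = _ := by congr 1; simp; ring

/-- A centred Gaussian integral with exponent `-t x²` decays like `1 / √t`, since the density is
bounded. -/
theorem integral_exp_neg_mul_sq_gaussianReal_le {v : ℝ≥0} (hv : v ≠ 0) {t : ℝ} (ht : 0 < t) :
    ∫ x, Real.exp (-t * x ^ 2) ∂gaussianReal 0 v ≤ (√(2 * Real.pi * v))⁻¹ * √(Real.pi / t) := by
  rw [integral_gaussianReal_eq_integral_smul hv, ← integral_gaussian t, ← integral_const_mul]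
  refine integral_mono_of_nonneg (ae_of_all _ fun x => ?_)
    ((integrable_exp_neg_mul_sq ht).const_mul _) (ae_of_all _ fun x => ?_)
  · exact mul_nonneg (gaussianPDFReal_nonneg _ _ _) (Real.exp_pos _).le
  · refine mul_le_mul_of_nonneg_right ?_ (Real.exp_pos _).le
    rw [gaussianPDFReal]
    refine mul_le_of_le_one_right (by positivity) (Real.exp_le_one_iff.2 ?_)
    rw [neg_div]
    exact neg_nonpos.2 (by positivity)

theorem exists_mul_le_gaussianReal_Icc {v : ℝ≥0} (hv : v ≠ 0) :
    ∃ c > 0, ∀ t : ℝ, 0 ≤ t → t ≤ 1 → c * t ≤ (gaussianReal 0 v).real (Set.Icc (-t) t) := by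
  refine ⟨gaussianPDFReal 0 v 1 * 2, mul_pos (gaussianPDFReal_pos _ _ _ hv) two_pos, ?_⟩
  intro t ht0 ht1
  rw [measureReal_def, gaussianReal_apply_eq_integral _ hv, ENNReal.toReal_ofReal
    (integral_nonneg fun x => gaussianPDFReal_nonneg _ _ _)]
  calc gaussianPDFReal 0 v 1 * 2 * t = ∫ _ in Set.Icc (-t) t, gaussianPDFReal 0 v 1 := by
        simp [measureReal_def, ENNReal.toReal_ofReal (by linarith : 0 ≤ t + t)]; ring
    _ ≤ _ := by
        refine setIntegral_mono_on (by simp) (integrable_gaussianPDFReal _ _).integrableOn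
          measurableSet_Icc fun x hx => ?_
        have hx1 : x ^ 2 ≤ 1 := by
          rw [sq_le_one_iff_abs_le_one]; exact abs_le.2 ⟨by linarith [hx.1], by linarith [hx.2]⟩
        unfold gaussianPDFReal
        refine mul_le_mul_of_nonneg_left (Real.exp_le_exp.2 (div_le_div_of_nonneg_right
          (neg_le_neg ?_) (by positivity))) (by positivity)
        rwa [sub_zero, sub_zero, one_pow]

instance (σ : ℝ) : IsProbabilityMeasure (complexGaussian σ) := by
  unfold complexGaussian
  exact Measure.isProbabilityMeasure_map (by fun_prop)

/-- The product of a set of real parts and a set of imaginary parts is a rectangle in `ℂ`, whose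
complex Gaussian probability factors. -/
theorem complexGaussian_real_reProdIm (σ : ℝ) (s t : Set ℝ) :
    (complexGaussian σ).real (s ×ℂ t) = (gaussianReal 0 (Real.toNNReal (σ ^ 2 / 2))).real s *
      (gaussianReal 0 (Real.toNNReal (σ ^ 2 / 2))).real t := by
  rw [complexGaussian, measureReal_def, MeasurableEquiv.map_apply]
  exact measureReal_prod_prod s t

theorem toNNReal_sq_div_two_ne_zero {σ : ℝ} (hσ : 0 < σ) : Real.toNNReal (σ ^ 2 / 2) ≠ 0 :=
  (Real.toNNReal_pos.2 (by positivity)).ne'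

/-- The probability that a complex Gaussian has squared modulus at most `1 / P` decays no faster
than `1 / P`. -/
theorem exists_div_le_complexGaussian_ball {σ : ℝ} (hσ : 0 < σ) :
    ∃ c > 0, ∀ P : ℝ, 1 ≤ P → c / P ≤ (complexGaussian σ).real {z | ‖z‖ ^ 2 * P ≤ 1} := by
  obtain ⟨c, hc, h⟩ := exists_mul_le_gaussianReal_Icc (toNNReal_sq_div_two_ne_zero hσ)
  refine ⟨c ^ 2 / 4, by positivity, fun P hP => ?_⟩
  have hP0 : 0 < P := by linarith
  -- the square of half side `t` is contained in the disc of radius `1 / √P`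
  set t : ℝ := (2 * √P)⁻¹ with ht
  have ht0 : 0 ≤ t := by positivity
  have htP : t ^ 2 * P = 1 / 4 := by
    rw [ht, inv_pow, mul_pow, Real.sq_sqrt hP0.le]; field_simp; norm_num
  have ht1 : t ≤ 1 := by nlinarith
  calc c ^ 2 / 4 / P = (c * t) * (c * t) := by
        have : t ^ 2 = 1 / 4 / P := by rw [eq_div_iff hP0.ne', htP]
        linear_combination (-c ^ 2) * this
    _ ≤ _ := mul_le_mul (h t ht0 ht1) (h t ht0 ht1) (by positivity) measureReal_nonneg
    _ = _ := (complexGaussian_real_reProdIm σ _ _).symm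
    _ ≤ _ := by
        refine measureReal_mono fun z hz => ?_
        have h1 : z.re ^ 2 ≤ t ^ 2 := sq_le_sq' hz.1.1 hz.1.2
        have h2 : z.im ^ 2 ≤ t ^ 2 := sq_le_sq' hz.2.1 hz.2.2
        have h3 : ‖z‖ ^ 2 = z.re ^ 2 + z.im ^ 2 := by
          rw [← Complex.normSq_eq_norm_sq, Complex.normSq_apply]; ring
        rw [Set.mem_ofPred_eq, h3]
        nlinarith

theorem complexGaussian_real_one_le_norm_pos {σ : ℝ} (hσ : 0 < σ) :
    0 < (complexGaussian σ).real {z | 1 ≤ ‖z‖} := by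
  have hv := toNNReal_sq_div_two_ne_zero hσ
  have h := complexGaussian_real_reProdIm σ (Set.Ioi 1) Set.univ
  refine lt_of_lt_of_le (h ▸ mul_pos (gaussianReal_real_pos_of_volume_ne_zero hv (by simp))
    (gaussianReal_real_pos_of_volume_ne_zero hv (by simp))) (measureReal_mono fun z hz => ?_)
  exact (le_of_lt hz.1).trans ((le_abs_self _).trans (Complex.abs_re_le_norm z))

/-- The complex Gaussian integral with exponent `-t |z|²` decays like `1 / t`. -/
theorem exists_integral_exp_complexGaussian_le {σ : ℝ} (hσ : 0 < σ) :
    ∃ K > 0, ∀ t : ℝ, 0 < t →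
      ∫ z, Real.exp (-t * ‖z‖ ^ 2) ∂complexGaussian σ ≤ K / t := by
  have hv := toNNReal_sq_div_two_ne_zero hσ
  set v := Real.toNNReal (σ ^ 2 / 2) with hvdef
  have hv0 : (0 : ℝ) < v := by exact_mod_cast pos_iff_ne_zero.2 hv
  refine ⟨(√(2 * Real.pi * v))⁻¹ ^ 2 * Real.pi, by positivity, fun t ht => ?_⟩
  have h1 := integral_exp_neg_mul_sq_gaussianReal_le hv ht
  have h0 : 0 ≤ ∫ x, Real.exp (-t * x ^ 2) ∂gaussianReal 0 v :=
    integral_nonneg fun x => (Real.exp_pos _).le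
  have heq : ∫ z, Real.exp (-t * ‖z‖ ^ 2) ∂complexGaussian σ =
      (∫ x, Real.exp (-t * x ^ 2) ∂gaussianReal 0 v) *
        ∫ x, Real.exp (-t * x ^ 2) ∂gaussianReal 0 v := by
    rw [complexGaussian, MeasureTheory.integral_map_equiv, ← integral_prod_mul]
    refine integral_congr_ae (ae_of_all _ fun p => ?_)
    have h3 (z : ℂ) : ‖z‖ ^ 2 = z.re ^ 2 + z.im ^ 2 := by
      rw [← Complex.normSq_eq_norm_sq, Complex.normSq_apply]; ring
    simp only [h3, ← Real.exp_add]
    congr 1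
    simp
    ring
  rw [heq]
  calc _ ≤ _ := mul_le_mul h1 h1 h0 (by positivity)
    _ = (√(2 * Real.pi * v))⁻¹ ^ 2 * √(Real.pi / t) ^ 2 := by ring
    _ = _ := by rw [Real.sq_sqrt (by positivity)]; ring

/-! ### Polynomial decay and logarithmic exponents -/

theorem neg_log_div_log_le {c y P : ℝ} {n : ℕ} (hc : 0 < c) (hP : 1 < P) (h : c / P ^ n ≤ y) :
    -Real.log y / Real.log P ≤ n - Real.log c / Real.log P := by
  have hP0 : 0 < P := by linarith
  have hl := Real.log_pos hP
  have h1 := Real.log_le_log (by positivity) h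
  rw [Real.log_div hc.ne' (by positivity), Real.log_pow] at h1
  rw [le_sub_iff_add_le, ← add_div, div_le_iff₀ hl]
  linarith

theorem le_neg_log_div_log {K y P : ℝ} {n : ℕ} (hK : 0 < K) (hP : 1 < P) (hy : 0 < y)
    (h : y ≤ K / P ^ n) : n - Real.log K / Real.log P ≤ -Real.log y / Real.log P := by
  have hP0 : 0 < P := by linarith
  have hl := Real.log_pos hP
  have h1 := Real.log_le_log hy h
  rw [Real.log_div hK.ne' (by positivity), Real.log_pow] at h1
  rw [sub_le_iff_le_add, ← add_div, le_div_iff₀ hl]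
  linarith

theorem tendsto_natCast_sub_div_log (n : ℕ) (a : ℝ) :
    Tendsto (fun P : ℝ => n - a / Real.log P) atTop (𝓝 (n : ℝ)) := by
  simpa using (tendsto_const_nhds (x := (n : ℝ))).sub (Real.tendsto_log_atTop.const_div_atTop a)

namespace RelayNetwork

variable {R : ℕ} (N : RelayNetwork R)

/-! ### The error rate of an optimal quantizer -/

instance : IsProbabilityMeasure N.channelLaw := by
  unfold channelLaw; infer_instance

theorem relayFactor_nonneg {P : ℝ} (hP : 0 < P) (h : ChannelState R) (r : Fin R) :
    0 ≤ N.relayFactor P h r := by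
  have := N.p_pos r
  have := N.p₀_pos
  unfold relayFactor
  positivity

theorem noise_pos {P : ℝ} (hP : 0 < P) (x : Fin R → ℂ) (h : ChannelState R) :
    0 < 1 + ∑ r, ‖x r‖ ^ 2 * ‖(h r).2‖ ^ 2 * N.relayFactor P h r := by
  have : 0 ≤ ∑ r, ‖x r‖ ^ 2 * ‖(h r).2‖ ^ 2 * N.relayFactor P h r :=
    Finset.sum_nonneg fun r _ => mul_nonneg (by positivity) (N.relayFactor_nonneg hP h r)
  linarith

theorem snr_nonneg {P : ℝ} (hP : 0 < P) (x : Fin R → ℂ) (h : ChannelState R) :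
    0 ≤ N.snr P x h := by
  have := N.p₀_pos
  exact div_nonneg (by positivity) (N.noise_pos hP x h).le

theorem continuous_snr {P : ℝ} (hP : 0 < P) (x : Fin R → ℂ) :
    Continuous fun h : ChannelState R => N.snr P x h := by
  have hρ (r : Fin R) : Continuous fun h : ChannelState R => N.relayFactor P h r := by
    have := N.p₀_pos
    unfold relayFactor
    exact Continuous.div (by fun_prop) (by fun_prop) fun h => by positivity
  unfold snr
  exact Continuous.div (by fun_prop) (by fun_prop) fun h => (N.noise_pos hP x h).ne'

variable {N} {C : Set (Fin R → ℂ)} {Q : ℝ → ChannelState R → Fin R → ℂ}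

/-- A quantizer need not be measurable, but its optimal SNR is: it is a pointwise maximum of
continuous functions of the channel state, hence lower semicontinuous. -/
theorem IsOptimalQuantizer.measurable_snr (hQ : N.IsOptimalQuantizer C Q) {P : ℝ} (hP : 0 < P) :
    Measurable fun h => N.snr P (Q P h) h := by
  refine LowerSemicontinuous.measurable (lowerSemicontinuous_iff.2 fun h₀ y hy => ?_)
  filter_upwards [(N.continuous_snr hP (Q P h₀)).continuousAt.eventually (lt_mem_nhds hy)] with h hh
  exact hh.trans_le ((hQ P hP h).2 _ (hQ P hP h₀).1)

theorem IsOptimalQuantizer.integrable (hQ : N.IsOptimalQuantizer C Q) {P : ℝ} (hP : 0 < P) :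
    Integrable (fun h => gaussianTail (√(2 * N.snr P (Q P h) h))) N.channelLaw := by
  have hm := hQ.measurable_snr hP
  refine Integrable.of_bound (gaussianTail_antitone.measurable.comp
    (by fun_prop : Measurable fun h => √(2 * N.snr P (Q P h) h))).aestronglyMeasurable 1
    (ae_of_all _ fun h => ?_)
  rw [Real.norm_of_nonneg (gaussianTail_nonneg _)]
  exact gaussianTail_le_one _

/-- If every codeword has SNR at most `B` on a product event, the error rate is at least a constant
multiple of the probability of the event. -/
theorem IsOptimalQuantizer.le_ser (hQ : N.IsOptimalQuantizer C Q) {P : ℝ} (hP : 0 < P) (B : ℝ)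
    {U V : Fin R → Set ℂ} (hU : ∀ r, MeasurableSet (U r)) (hV : ∀ r, MeasurableSet (V r))
    (hB : ∀ h : ChannelState R, (∀ r, (h r).1 ∈ U r) → (∀ r, (h r).2 ∈ V r) →
      ∀ x ∈ C, N.snr P x h ≤ B) :
    gaussianTail (√(2 * B)) * ∏ r, ((complexGaussian (N.σf r)).real (U r) *
      (complexGaussian (N.σg r)).real (V r)) ≤ N.ser P (Q P) := by
  set A : Set (ChannelState R) := Set.pi Set.univ fun r => U r ×ˢ V r
  have hA : MeasurableSet A := MeasurableSet.univ_pi fun r => (hU r).prod (hV r)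
  have hAP : N.channelLaw.real A = ∏ r, ((complexGaussian (N.σf r)).real (U r) *
      (complexGaussian (N.σg r)).real (V r)) := by
    simp_rw [← measureReal_prod_prod]
    rw [channelLaw, measureReal_def, Measure.pi_pi, ENNReal.toReal_prod]
    rfl
  have hi := hQ.integrable hP
  calc _ = ∫ _ in A, gaussianTail (√(2 * B)) ∂N.channelLaw := by
        rw [setIntegral_const, hAP, smul_eq_mul, mul_comm]
    _ ≤ ∫ h in A, gaussianTail (√(2 * N.snr P (Q P h) h)) ∂N.channelLaw := by
        refine setIntegral_mono_on (by simp) hi.integrableOn hA fun h hh => ?_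
        have hh' : ∀ r, h r ∈ U r ×ˢ V r := fun r => hh r (Set.mem_univ r)
        have := hB h (fun r => (hh' r).1) (fun r => (hh' r).2) _ (hQ P hP h).1
        exact gaussianTail_antitone (Real.sqrt_le_sqrt (by linarith))
    _ ≤ _ := setIntegral_le_integral hi (ae_of_all _ fun h => gaussianTail_nonneg _)

variable (N)

/-! ### Lower bounds on the error rate -/

/-- Cauchy–Schwarz: the received signal through a set of relays is bounded by the product of the
transmitter-to-relay gains and the noise power these relays forward. -/
theorem sq_norm_sum_le {P : ℝ} (hP : 0 < P) (x : Fin R → ℂ) (h : ChannelState R)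
    (T : Finset (Fin R)) :
    ‖∑ r ∈ T, x r * (h r).1 * (h r).2 * (√(N.relayFactor P h r) : ℂ)‖ ^ 2 ≤
      (∑ r ∈ T, ‖(h r).1‖ ^ 2) * ∑ r ∈ T, ‖x r‖ ^ 2 * ‖(h r).2‖ ^ 2 * N.relayFactor P h r := by
  calc _ ≤ (∑ r ∈ T, ‖(h r).1‖ * (‖x r‖ * ‖(h r).2‖ * √(N.relayFactor P h r))) ^ 2 := by
        refine pow_le_pow_left₀ (norm_nonneg _) ((norm_sum_le _ _).trans_eq ?_) 2
        refine Finset.sum_congr rfl fun r _ => ?_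
        rw [norm_mul, norm_mul, norm_mul, Complex.norm_real,
          Real.norm_of_nonneg (Real.sqrt_nonneg _)]
        ring
    _ ≤ (∑ r ∈ T, ‖(h r).1‖ ^ 2) *
          ∑ r ∈ T, (‖x r‖ * ‖(h r).2‖ * √(N.relayFactor P h r)) ^ 2 :=
        Finset.sum_mul_sq_le_sq_mul_sq _ _ _
    _ = _ := by
        congr 1
        refine Finset.sum_congr rfl fun r _ => ?_
        rw [mul_pow, mul_pow, Real.sq_sqrt (N.relayFactor_nonneg hP h r)]

theorem sum_sq_norm_mul_le {P : ℝ} {h : ChannelState R} {T : Finset (Fin R)}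
    (hf : ∀ s ∈ T, ‖(h s).1‖ ^ 2 * P ≤ 1) : (∑ s ∈ T, ‖(h s).1‖ ^ 2) * P ≤ R := by
  rw [Finset.sum_mul]
  refine (Finset.sum_le_card_nsmul _ _ 1 hf).trans ?_
  rw [nsmul_eq_mul, mul_one]
  exact_mod_cast (Finset.card_le_univ T).trans_eq (Fintype.card_fin R)

/-- If all channels from the transmitter are of order `1 / √P`, no beamforming vector has a large
SNR. -/
theorem snr_le_of_forall_weak {P : ℝ} (hP : 0 < P) {h : ChannelState R}
    (hf : ∀ s, ‖(h s).1‖ ^ 2 * P ≤ 1) (x : Fin R → ℂ) : N.snr P x h ≤ N.p₀ * R := by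
  have h0 := N.p₀_pos
  have hD := N.noise_pos hP x h
  rw [snr, div_le_iff₀ hD]
  calc _ ≤ N.p₀ * P * ((∑ r, ‖(h r).1‖ ^ 2) *
          ∑ r, ‖x r‖ ^ 2 * ‖(h r).2‖ ^ 2 * N.relayFactor P h r) := by
        gcongr; exact N.sq_norm_sum_le hP x h Finset.univ
    _ ≤ N.p₀ * P * ((∑ r, ‖(h r).1‖ ^ 2) *
          (1 + ∑ r, ‖x r‖ ^ 2 * ‖(h r).2‖ ^ 2 * N.relayFactor P h r)) := by
        gcongr; linarith
    _ = N.p₀ * ((∑ r, ‖(h r).1‖ ^ 2) * P) *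
          (1 + ∑ r, ‖x r‖ ^ 2 * ‖(h r).2‖ ^ 2 * N.relayFactor P h r) := by ring
    _ ≤ _ := by
        gcongr; exact sum_sq_norm_mul_le fun s _ => hf s

/-- Suppose all relays other than `r` have a weak channel from the transmitter and a good channel to
the receiver, while relay `r` has a bounded channel to the receiver. A beamforming vector that gives
weight at least `δ` to the other relays then forwards noise of power of order `P`, which drowns the
signal through relay `r`. -/
theorem snr_le_of_forall_ne_weak (r : Fin R) {δ κ : ℝ} (hδ : 0 < δ) (hκ : 0 < κ)
    (hκp : ∀ s, κ ≤ N.p s / (1 + N.p₀)) {P : ℝ} (hP : 0 < P) {h : ChannelState R}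
    (hf : ∀ s ≠ r, ‖(h s).1‖ ^ 2 * P ≤ 1) (hg : ∀ s ≠ r, 1 ≤ ‖(h s).2‖) (hgr : ‖(h r).2‖ ≤ 1)
    {x : Fin R → ℂ} (hx1 : ‖x‖ = 1) (hx : δ ≤ ∑ s ∈ Finset.univ.erase r, ‖x s‖ ^ 2) :
    N.snr P x h ≤ 2 * (N.p r / (κ * δ)) + 2 * (N.p₀ * R) := by
  have h0 := N.p₀_pos
  have hpr := N.p_pos r
  have hD := N.noise_pos hP x h
  have hxr : ‖x r‖ ≤ 1 := hx1 ▸ norm_le_pi_norm x r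
  rw [snr, div_le_iff₀ hD]
  set T := Finset.univ.erase r with hT
  have hr : r ∈ Finset.univ := Finset.mem_univ r
  have hnoise : ∑ s ∈ T, ‖x s‖ ^ 2 * ‖(h s).2‖ ^ 2 * N.relayFactor P h s ≤
      1 + ∑ s, ‖x s‖ ^ 2 * ‖(h s).2‖ ^ 2 * N.relayFactor P h s := by
    rw [← Finset.add_sum_erase _ _ hr]
    have := mul_nonneg (by positivity : 0 ≤ ‖x r‖ ^ 2 * ‖(h r).2‖ ^ 2) (N.relayFactor_nonneg hP h r)
    linarith
  set D := 1 + ∑ s, ‖x s‖ ^ 2 * ‖(h s).2‖ ^ 2 * N.relayFactor P h s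
  -- the noise forwarded by the relays other than `r`
  have hDlow : κ * δ * P ≤ D := by
    refine le_trans ?_ hnoise
    calc κ * δ * P ≤ κ * (∑ s ∈ T, ‖x s‖ ^ 2) * P := by gcongr
      _ = ∑ s ∈ T, ‖x s‖ ^ 2 * 1 ^ 2 * (κ * P) := by
          rw [Finset.mul_sum, Finset.sum_mul]
          exact Finset.sum_congr rfl fun s _ => by ring
      _ ≤ _ := by
          refine Finset.sum_le_sum fun s hs => ?_
          have hsr : s ≠ r := Finset.ne_of_mem_erase hs
          have hρ : κ * P ≤ N.relayFactor P h s := by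
            have := N.p_pos s
            calc κ * P ≤ N.p s / (1 + N.p₀) * P := by gcongr; exact hκp s
              _ = N.p s * P / (1 + N.p₀) := by ring
              _ ≤ _ := by
                  unfold relayFactor
                  refine div_le_div_of_nonneg_left (by positivity) (by positivity) ?_
                  nlinarith [hf s hsr]
          have := hg s hsr
          gcongr
  have hrest : N.p₀ * P * ‖∑ s ∈ T, x s * (h s).1 * (h s).2 * (√(N.relayFactor P h s) : ℂ)‖ ^ 2 ≤
      N.p₀ * R * D := by
    calc _ ≤ N.p₀ * P * ((∑ s ∈ T, ‖(h s).1‖ ^ 2) * D) := by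
          gcongr
          exact (N.sq_norm_sum_le hP x h T).trans (by gcongr)
      _ = N.p₀ * ((∑ s ∈ T, ‖(h s).1‖ ^ 2) * P) * D := by ring
      _ ≤ _ := by
          gcongr
          exact sum_sq_norm_mul_le fun s hs => hf s (Finset.ne_of_mem_erase hs)
  -- the signal through relay `r`
  have hterm : N.p₀ * P * ‖x r * (h r).1 * (h r).2 * (√(N.relayFactor P h r) : ℂ)‖ ^ 2 ≤
      N.p r / (κ * δ) * D := by
    have hρ : N.p₀ * P * (‖(h r).1‖ ^ 2 * N.relayFactor P h r) ≤ N.p r * P := by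
      have hb : 0 < 1 + ‖(h r).1‖ ^ 2 * (N.p₀ * P) := by positivity
      rw [relayFactor, ← mul_div_assoc, ← mul_div_assoc, div_le_iff₀ hb]
      have : 0 < N.p r * P := by positivity
      linarith
    rw [norm_mul, norm_mul, norm_mul, Complex.norm_real,
      Real.norm_of_nonneg (Real.sqrt_nonneg _), mul_pow, mul_pow, mul_pow,
      Real.sq_sqrt (N.relayFactor_nonneg hP h r)]
    have hnn := mul_nonneg (by positivity : 0 ≤ N.p₀ * P * ‖(h r).1‖ ^ 2)
      (N.relayFactor_nonneg hP h r)
    calc _ = ‖x r‖ ^ 2 * ‖(h r).2‖ ^ 2 * (N.p₀ * P * ‖(h r).1‖ ^ 2 * N.relayFactor P h r) := by ring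
      _ ≤ 1 ^ 2 * 1 ^ 2 * (N.p₀ * P * ‖(h r).1‖ ^ 2 * N.relayFactor P h r) := by gcongr
      _ ≤ N.p r * P := by linarith
      _ = N.p r / (κ * δ) * (κ * δ * P) := by field_simp
      _ ≤ _ := by gcongr
  rw [← Finset.add_sum_erase _ _ hr]
  refine (mul_le_mul_of_nonneg_left (pow_le_pow_left₀ (norm_nonneg _) (norm_add_le _ _) 2)
    (by positivity)).trans ?_
  refine (mul_le_mul_of_nonneg_left add_sq_le (by positivity)).trans ?_
  linarith

theorem measurableSet_weak (P : ℝ) : MeasurableSet {z : ℂ | ‖z‖ ^ 2 * P ≤ 1} :=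
  measurableSet_le (by fun_prop) (by fun_prop)

variable {N}

/-- No codebook has diversity more than `R`: all channels from the transmitter are weak with
probability of order `P ^ (-R)`. -/
theorem IsOptimalQuantizer.exists_div_pow_le_ser (hQ : N.IsOptimalQuantizer C Q) :
    ∃ c > 0, ∀ P : ℝ, 1 ≤ P → c / P ^ R ≤ N.ser P (Q P) := by
  choose c hc hcP using fun r => exists_div_le_complexGaussian_ball (N.σf_pos r)
  refine ⟨gaussianTail (√(2 * (N.p₀ * R))) * ∏ r, c r,
    mul_pos (gaussianTail_pos _) (Finset.prod_pos fun r _ => hc r), fun P hP => ?_⟩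
  have hP0 : 0 < P := by linarith
  refine le_trans ?_ (hQ.le_ser hP0 (N.p₀ * R) (U := fun _ => {z | ‖z‖ ^ 2 * P ≤ 1})
    (V := fun _ => Set.univ) (fun _ => measurableSet_weak P) (fun _ => MeasurableSet.univ)
    fun h hU _ x _ => N.snr_le_of_forall_weak hP0 hU x)
  rw [mul_div_assoc]
  refine mul_le_mul_of_nonneg_left ?_ (gaussianTail_nonneg _)
  calc (∏ r, c r) / P ^ R = ∏ r, c r / P := by simp
    _ ≤ _ := Finset.prod_le_prod (fun r _ => (div_pos (hc r) hP0).le) fun r _ => by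
        simpa using hcP r P hP

/-- If every codeword uses some relay other than `r`, one factor `1 / P` is lost: relay `r` need not
have a weak channel from the transmitter. -/
theorem IsOptimalQuantizer.exists_div_pow_pred_le_ser (hQ : N.IsOptimalQuantizer C Q)
    (hCX : C ⊆ unitSupVectors R) (r : Fin R) {δ : ℝ} (hδ : 0 < δ)
    (hδC : ∀ x ∈ C, δ ≤ ∑ s ∈ Finset.univ.erase r, ‖x s‖ ^ 2) :
    ∃ c > 0, ∀ P : ℝ, 1 ≤ P → c / P ^ (R - 1) ≤ N.ser P (Q P) := by
  have h0 := N.p₀_pos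
  have : Nonempty (Fin R) := ⟨r⟩
  obtain ⟨s₀, hs₀⟩ := Finite.exists_min fun s => N.p s / (1 + N.p₀)
  have hκ : 0 < N.p s₀ / (1 + N.p₀) := div_pos (N.p_pos s₀) (by positivity)
  set B := 2 * (N.p r / (N.p s₀ / (1 + N.p₀) * δ)) + 2 * (N.p₀ * R)
  choose c hc hcP using fun r => exists_div_le_complexGaussian_ball (N.σf_pos r)
  choose d hd hdP using fun r => exists_div_le_complexGaussian_ball (N.σg_pos r)
  set m : Fin R → ℝ := fun s => (complexGaussian (N.σg s)).real {z | 1 ≤ ‖z‖}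
  have hm (s) : 0 < m s := complexGaussian_real_one_le_norm_pos (N.σg_pos s)
  set T := Finset.univ.erase r with hT
  have hcard : T.card = R - 1 := by simp [hT]
  refine ⟨gaussianTail (√(2 * B)) * (d r * ∏ s ∈ T, c s * m s),
    mul_pos (gaussianTail_pos _) (mul_pos (hd r) (Finset.prod_pos fun s _ => mul_pos (hc s) (hm s))),
    fun P hP => ?_⟩
  have hP0 : 0 < P := by linarith
  refine le_trans ?_ (hQ.le_ser hP0 B
    (U := fun s => if s = r then Set.univ else {z | ‖z‖ ^ 2 * P ≤ 1})
    (V := fun s => if s = r then {z | ‖z‖ ^ 2 * 1 ≤ 1} else {z | 1 ≤ ‖z‖})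
    (fun s => ?_) (fun s => ?_) fun h hU hV x hx => ?_)
  · rw [mul_div_assoc]
    refine mul_le_mul_of_nonneg_left ?_ (gaussianTail_nonneg _)
    rw [← Finset.mul_prod_erase _ _ (Finset.mem_univ r), mul_div_assoc]
    refine mul_le_mul ?_ ?_ ?_ (by positivity)
    · simpa using hdP r 1 le_rfl
    · calc (∏ s ∈ T, c s * m s) / P ^ (R - 1) = ∏ s ∈ T, c s / P * m s := by
            simp only [div_mul_eq_mul_div, Finset.prod_div_distrib, Finset.prod_const, hcard]
        _ ≤ _ := Finset.prod_le_prod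
            (fun s _ => (mul_pos (div_pos (hc s) hP0) (hm s)).le) fun s hs => by
              simp only [Finset.ne_of_mem_erase hs, if_false]
              exact mul_le_mul_of_nonneg_right (hcP s P hP) (hm s).le
    · exact div_nonneg (Finset.prod_nonneg fun s _ => (mul_pos (hc s) (hm s)).le) (by positivity)
  · split_ifs
    exacts [MeasurableSet.univ, measurableSet_weak P]
  · split_ifs
    exacts [measurableSet_weak 1, measurableSet_le (by fun_prop) (by fun_prop)]
  · refine N.snr_le_of_forall_ne_weak r hδ hκ hs₀ hP0 (fun s hs => ?_) (fun s hs => ?_) ?_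
      (hCX hx) (hδC x hx)
    · simpa [hs] using hU s
    · simpa [hs] using hV s
    · simpa using hV r

/-! ### Upper bound for single-relay selection -/

variable (N)

/-- The SNR of relay `r` alone is `a b / (1 + a + b)`, where `a` and `b` are the received powers of
the two hops; the weaker hop determines its order of magnitude. -/
theorem min_le_snr_srsVector {P : ℝ} (hP : 0 < P) (h : ChannelState R) (r : Fin R) (t : ℝ) :
    min (‖(h r).1‖ ^ 2 * (N.p₀ * P)) (‖(h r).2‖ ^ 2 * (N.p r * P)) / 2 - 1 / 4 ≤
      N.snr P (srsVector r t) h := by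
  have h0 := N.p₀_pos
  have hr := N.p_pos r
  set a := ‖(h r).1‖ ^ 2 * (N.p₀ * P) with ha
  set b := ‖(h r).2‖ ^ 2 * (N.p r * P) with hb
  have ha0 : 0 ≤ a := by positivity
  have hb0 : 0 ≤ b := by positivity
  have hnorm : ‖srsVector r t r‖ = 1 := by
    simp [srsVector, Complex.norm_exp_ofReal_mul_I]
  have hne (s : Fin R) (hs : s ≠ r) : srsVector r t s = 0 := by
    simp [srsVector, hs]
  have hρ : N.relayFactor P h r = N.p r * P / (1 + a) := rfl
  have hsnr : N.snr P (srsVector r t) h = a * b / (1 + a + b) := by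
    rw [snr, Finset.sum_eq_single r (fun s _ hs => by simp [hne s hs]) (by simp),
      Finset.sum_eq_single r (fun s _ hs => by simp [hne s hs]) (by simp),
      norm_mul, norm_mul, norm_mul, Complex.norm_real, Real.norm_of_nonneg (Real.sqrt_nonneg _),
      mul_pow, mul_pow, mul_pow, Real.sq_sqrt (N.relayFactor_nonneg hP h r), hnorm, hρ]
    have h1 : 0 < 1 + a := by positivity
    have h2 : 0 < 1 + a + b := by positivity
    have h3 : 1 + 1 ^ 2 * ‖(h r).2‖ ^ 2 * (N.p r * P / (1 + a)) = (1 + a + b) / (1 + a) := by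
      rw [hb]; field_simp
    rw [h3, div_eq_div_iff (by positivity) (by positivity)]
    rw [ha, hb]
    rw [ha] at h1
    field_simp
  rw [hsnr, le_div_iff₀ (by positivity)]
  rcases le_total a b with hab | hab
  · rw [min_eq_left hab]; nlinarith
  · rw [min_eq_right hab]; nlinarith

variable {N}

/-- Pointwise factorization: the best relay is at least as good as the average one, so the error
probability is at most a product over the relays. -/
theorem IsOptimalQuantizer.gaussianTail_le_prod (hQ : N.IsOptimalQuantizer C Q) (hR : 0 < R)
    {θ : Fin R → ℝ} (hθ : srsCodebook θ ⊆ C) {P : ℝ} (hP : 0 < P) (h : ChannelState R) :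
    gaussianTail (√(2 * N.snr P (Q P h) h)) ≤
      ∏ r, Real.exp (1 / (4 * R)) * (Real.exp (-(N.p₀ * P / (2 * R)) * ‖(h r).1‖ ^ 2) +
        Real.exp (-(N.p r * P / (2 * R)) * ‖(h r).2‖ ^ 2)) := by
  have hR' : (0 : ℝ) < R := by exact_mod_cast hR
  set γ := N.snr P (Q P h) h
  have hγ0 : 0 ≤ γ := N.snr_nonneg hP _ _
  have hγ (r : Fin R) : min (‖(h r).1‖ ^ 2 * (N.p₀ * P)) (‖(h r).2‖ ^ 2 * (N.p r * P)) / 2 - 1 / 4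
      ≤ γ :=
    (N.min_le_snr_srsVector hP h r (θ r)).trans ((hQ P hP h).2 _ (hθ ⟨r, rfl⟩))
  calc _ ≤ Real.exp (-γ) := by
        refine (gaussianTail_le_exp (Real.sqrt_nonneg _)).trans_eq ?_
        rw [Real.sq_sqrt (by positivity)]; ring_nf
    _ = ∏ _r : Fin R, Real.exp (-γ / R) := by
        rw [Finset.prod_const, Finset.card_univ, Fintype.card_fin, ← Real.exp_nat_mul]
        congr 1; field_simp
    _ ≤ _ := by
        refine Finset.prod_le_prod (fun r _ => (Real.exp_pos _).le) fun r _ => ?_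
        have key (y : ℝ) (hy : y / 2 - 1 / 4 ≤ γ) :
            Real.exp (-γ / R) ≤ Real.exp (1 / (4 * R)) * Real.exp (-(y / (2 * R))) := by
          rw [← Real.exp_add, Real.exp_le_exp, div_le_iff₀ hR']
          have : (1 / (4 * R) + -(y / (2 * R))) * (R : ℝ) = 1 / 4 - y / 2 := by field_simp; ring
          linarith
        have hr := hγ r
        rw [mul_add]
        rcases min_choice (‖(h r).1‖ ^ 2 * (N.p₀ * P)) (‖(h r).2‖ ^ 2 * (N.p r * P)) with hm | hm
        · rw [hm] at hr
          refine (key _ hr).trans (le_add_of_le_of_nonneg (le_of_eq ?_) (by positivity))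
          congr 2; ring
        · rw [hm] at hr
          refine (key _ hr).trans (le_add_of_nonneg_of_le (by positivity) (le_of_eq ?_))
          congr 2; ring

theorem integrable_exp_neg_mul_sq_norm (σ : ℝ) {t : ℝ} (ht : 0 ≤ t) :
    Integrable (fun z => Real.exp (-t * ‖z‖ ^ 2)) (complexGaussian σ) := by
  refine Integrable.of_bound (by fun_prop) 1 (ae_of_all _ fun z => ?_)
  rw [Real.norm_of_nonneg (Real.exp_pos _).le, Real.exp_le_one_iff]
  nlinarith [mul_nonneg ht (sq_nonneg ‖z‖)]

theorem IsOptimalQuantizer.exists_ser_le_div_pow (hQ : N.IsOptimalQuantizer C Q) (hR : 0 < R)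
    {θ : Fin R → ℝ} (hθ : srsCodebook θ ⊆ C) :
    ∃ K > 0, ∀ P : ℝ, 0 < P → N.ser P (Q P) ≤ K / P ^ R := by
  have hR' : (0 : ℝ) < R := by exact_mod_cast hR
  have h0 := N.p₀_pos
  choose Kf hKf hf using fun r => exists_integral_exp_complexGaussian_le (N.σf_pos r)
  choose Kg hKg hg using fun r => exists_integral_exp_complexGaussian_le (N.σg_pos r)
  refine ⟨∏ r, Real.exp (1 / (4 * R)) * (Kf r / (N.p₀ / (2 * R)) + Kg r / (N.p r / (2 * R))),
    Finset.prod_pos fun r _ => ?_, fun P hP => ?_⟩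
  · have := N.p_pos r
    have := hKf r
    have := hKg r
    positivity
  have hF (r : Fin R) : Integrable (fun z : ℂ × ℂ => Real.exp (-(N.p₀ * P / (2 * R)) * ‖z.1‖ ^ 2))
      ((complexGaussian (N.σf r)).prod (complexGaussian (N.σg r))) :=
    (integrable_exp_neg_mul_sq_norm _ (by positivity)).comp_fst _
  have hG (r : Fin R) : Integrable (fun z : ℂ × ℂ => Real.exp (-(N.p r * P / (2 * R)) * ‖z.2‖ ^ 2))
      ((complexGaussian (N.σf r)).prod (complexGaussian (N.σg r))) :=
    (integrable_exp_neg_mul_sq_norm _ (by have := N.p_pos r; positivity)).comp_snd _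
  calc N.ser P (Q P) ≤ ∫ h, ∏ r, Real.exp (1 / (4 * R)) *
          (Real.exp (-(N.p₀ * P / (2 * R)) * ‖(h r).1‖ ^ 2) +
          Real.exp (-(N.p r * P / (2 * R)) * ‖(h r).2‖ ^ 2)) ∂N.channelLaw := by
        refine integral_mono (hQ.integrable hP) ?_ (hQ.gaussianTail_le_prod hR hθ hP)
        exact Integrable.fintype_prod_dep fun r => ((hF r).add (hG r)).const_mul _
    _ = ∏ r, ∫ z : ℂ × ℂ, Real.exp (1 / (4 * R)) *
          (Real.exp (-(N.p₀ * P / (2 * R)) * ‖z.1‖ ^ 2) +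
          Real.exp (-(N.p r * P / (2 * R)) * ‖z.2‖ ^ 2))
          ∂((complexGaussian (N.σf r)).prod (complexGaussian (N.σg r))) :=
        integral_fintype_prod_eq_prod fun r (z : ℂ × ℂ) => Real.exp (1 / (4 * R)) *
          (Real.exp (-(N.p₀ * P / (2 * R)) * ‖z.1‖ ^ 2) +
          Real.exp (-(N.p r * P / (2 * R)) * ‖z.2‖ ^ 2))
    _ ≤ ∏ r, Real.exp (1 / (4 * R)) *
          (Kf r / (N.p₀ / (2 * R)) + Kg r / (N.p r / (2 * R))) / P := by
        refine Finset.prod_le_prod (fun r _ => integral_nonneg fun z => by positivity) fun r _ => ?_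
        have hr := N.p_pos r
        rw [integral_const_mul, integral_add (hF r) (hG r), integral_fun_fst
          (f := fun z : ℂ => Real.exp (-(N.p₀ * P / (2 * R)) * ‖z‖ ^ 2)), integral_fun_snd
          (f := fun z : ℂ => Real.exp (-(N.p r * P / (2 * R)) * ‖z‖ ^ 2)), mul_div_assoc (Real.exp _), add_div]
        simp only [probReal_univ, one_smul]
        gcongr
        · refine (hf r _ (by positivity)).trans_eq ?_
          field_simp
        · refine (hg r _ (by positivity)).trans_eq ?_
          field_simp
    _ = _ := by simp

end RelayNetwork

/-! ### The characterization -/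

/-- A codebook without a vector selecting relay `r` alone gives a weight bounded away from zero to
the other relays, by compactness. -/
theorem exists_forall_le_sum_erase {R : ℕ} {C : Set (Fin R → ℂ)} (hC : IsCompact C)
    (hCX : C ⊆ unitSupVectors R) (r : Fin R) (hr : ∀ t, srsVector r t ∉ C) :
    ∃ δ > 0, ∀ x ∈ C, δ ≤ ∑ s ∈ Finset.univ.erase r, ‖x s‖ ^ 2 := by
  refine hC.exists_forall_le' (by fun_prop) fun x hx => ?_
  by_contra hcon
  have hz : ∀ s ∈ Finset.univ.erase r, ‖x s‖ ^ 2 = 0 :=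
    (Finset.sum_eq_zero_iff_of_nonneg fun s _ => by positivity).1
      (le_antisymm (not_lt.1 hcon) (Finset.sum_nonneg fun s _ => by positivity))
  have hs (s : Fin R) (hsr : s ≠ r) : x s = 0 := by
    simpa using hz s (Finset.mem_erase.2 ⟨hsr, Finset.mem_univ s⟩)
  have hx' : x = Pi.single r (x r) := by
    ext s
    by_cases hsr : s = r
    · subst hsr; simp
    · simp [hsr, hs s hsr]
  have hn : ‖x r‖ = 1 := by
    have h1 : ‖x‖ = 1 := hCX hx
    rwa [hx', Pi.norm_single] at h1
  refine hr (x r).arg ?_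
  have := Complex.norm_mul_exp_arg_mul_I (x r)
  rw [hn, Complex.ofReal_one, one_mul] at this
  rwa [srsVector, this, ← hx']

/-- A compact power-independent codebook `C` of beamforming vectors of sup-norm `1` has
diversity `R` if and only if it contains a single-relay selection codebook. -/
theorem theorem2 {R : ℕ} (hR : 0 < R) (N : RelayNetwork R) (C : Set (Fin R → ℂ))
    (hC : IsCompact C) (hCX : C ⊆ unitSupVectors R)
    (Q : ℝ → ChannelState R → Fin R → ℂ) (hQ : N.IsOptimalQuantizer C Q) :
    N.HasDiversity Q R ↔ ∃ θ : Fin R → ℝ, srsCodebook θ ⊆ C := by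
  constructor
  · intro hdiv
    by_contra hno
    obtain ⟨r, hr⟩ : ∃ r : Fin R, ∀ t, srsVector r t ∉ C := by
      by_contra! hall
      choose θ hθ using hall
      exact hno ⟨θ, Set.range_subset_iff.2 hθ⟩
    obtain ⟨δ, hδ, hδC⟩ := exists_forall_le_sum_erase hC hCX r hr
    obtain ⟨c, hc, hser⟩ := hQ.exists_div_pow_pred_le_ser hCX r hδ hδC
    have hle : (R : ℝ) ≤ (R - 1 : ℕ) :=
      le_of_tendsto_of_tendsto hdiv (tendsto_natCast_sub_div_log (R - 1) (Real.log c))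
        ((eventually_gt_atTop 1).mono fun P hP => neg_log_div_log_le hc hP (hser P hP.le))
    have : R ≤ R - 1 := by exact_mod_cast hle
    omega
  · rintro ⟨θ, hθ⟩
    obtain ⟨c, hc, hlow⟩ := hQ.exists_div_pow_le_ser
    obtain ⟨K, hK, hup⟩ := hQ.exists_ser_le_div_pow hR hθ
    refine tendsto_of_tendsto_of_tendsto_of_le_of_le' (tendsto_natCast_sub_div_log R (Real.log K))
      (tendsto_natCast_sub_div_log R (Real.log c)) ?_ ?_
    · filter_upwards [eventually_gt_atTop 1] with P hP
      have hP0 : 0 < P := by linarith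
      exact le_neg_log_div_log hK hP ((div_pos hc (by positivity)).trans_le (hlow P hP.le))
        (hup P hP0)
    · filter_upwards [eventually_gt_atTop 1] with P hP
      exact neg_log_div_log_le hc hP (hlow P hP.le)
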